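/- Let $d\ge 2$ be an integer. Points $q_1,\dots,q_n\in\mathbb{R}^d$ are in general position if they are affinely independent, and in good position if moreover $|q_1-q_i|=|q_2-q_i|=\dots=|q_{i-1}-q_i|$ for $3\le i\le n$. A $d$-dimensional iterated circumcenter sequence (ICS) is a sequence $p=(p_i)_{i\ge 1}$ of points in $\mathbb{R}^d$ such that for every $i\ge 1$ the points $p_i,p_{i+1},\dots,p_{i+d}$ are in general position and $p_{i+d+1}$ is the center of the unique sphere in $\mathbb{R}^d$ through them. It is special if $p_1,\dots,p_{d+1}$ are in good position, and periodic if there is an integer $m>0$ with $p_{i+m}=p_i$ for all $i\ge 1$. The scale factor of a special ICS $p$ is $$\frac{1}{2^{d+2}\sqrt{a_1a_2\cdots a_{d+2}}},\qquad\text{where } a_i=\frac{|p_i-p_{i+1}|^2}{4\,|p_{i+1}-p_{i+2}|^2}.$$ Then for every real number $r\in[\cos^{d+2}(\pi/(d+2)),\infty)$ there is a special $d$-dimensional ICS with scale factor $r$. In particular, there exists a periodic $d$-dimensional ICS. -/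

import Mathlib

/-- Points `q 0, …, q (n - 1)` of `ℝ^d` are in good position if they are in general position
(affinely independent) and every point is equidistant from all the points before it. -/
structure InGoodPosition {d n : ℕ} (q : Fin n → EuclideanSpace ℝ (Fin d)) : Prop where
  affineIndependent : AffineIndependent ℝ q
  dist_eq : ∀ i j k : Fin n, j < i → k < i → dist (q j) (q i) = dist (q k) (q i)

/-- A `d`-dimensional iterated circumcenter sequence, indexed from `0`: any `d + 1` consecutive
points are in general position, and the next point is the center of the sphere through them. -/
def IsICS (d : ℕ) (p : ℕ → EuclideanSpace ℝ (Fin d)) : Prop :=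
  ∀ i : ℕ, ∃ h : AffineIndependent ℝ (fun j : Fin (d + 1) => p (i + (j : ℕ))),
    p (i + d + 1) =
      (⟨fun j : Fin (d + 1) => p (i + (j : ℕ)), h⟩ :
        Affine.Simplex ℝ (EuclideanSpace ℝ (Fin d)) d).circumcenter

/-- An ICS is special if its first `d + 1` points are in good position. -/
def IsSpecialICS (d : ℕ) (p : ℕ → EuclideanSpace ℝ (Fin d)) : Prop :=
  IsICS d p ∧ InGoodPosition (fun j : Fin (d + 1) => p (j : ℕ))

/-- A sequence is periodic if it is invariant under the shift by some `m > 0`. -/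
def IsPeriodicSeq {d : ℕ} (p : ℕ → EuclideanSpace ℝ (Fin d)) : Prop :=
  ∃ m : ℕ, 0 < m ∧ ∀ i : ℕ, p i = p (i + m)

/-- The characteristic sequence of `p`. -/
noncomputable def characteristicSeq {d : ℕ} (p : ℕ → EuclideanSpace ℝ (Fin d)) (i : ℕ) : ℝ :=
  dist (p i) (p (i + 1)) ^ 2 / (4 * dist (p (i + 1)) (p (i + 2)) ^ 2)

/-- The scale factor of `p`, from the first `d + 2` terms of its characteristic sequence. -/
noncomputable def scaleFactor (d : ℕ) (p : ℕ → EuclideanSpace ℝ (Fin d)) : ℝ :=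
  1 / (2 ^ (d + 2) * Real.sqrt (∏ i ∈ Finset.range (d + 2), characteristicSeq p i))

/-! A special ICS is encoded by its edges: each new point is equidistant from the `d + 1` before it
as soon as each edge `e k` has inner product `-‖e k‖ ^ 2 / 2` with the next edge and is orthogonal
to the following ones. So the Gram matrix of `d + 1` consecutive edges is tridiagonal, and it must
be singular to fit in `ℝ^d`. Up to rescaling, such matrices come from angles `θ` with `θ (j + (d +
2)) = θ j + π`: the vector `gapSin θ k (i + 1)`, `k ≤ i ≤ k + d`, is in the kernel of `edgeGram`,
because the sine vanishes at both ends, `0` and `π`. This kernel relation determines each direction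
from the `d` before it and forces `E (k + (d + 2)) = -E k` (`exists_edge_directions`).

Rescaling by `edgeScale` gives the ICS, with scale factor `edgeScale θ (d + 2)`. One gap `x` and `d
+ 1` gaps `y` per period then realize every required value by continuity. Scale factor `1` makes the
edges change sign after `d + 2` steps, hence periodicity. -/

/-! ### Sines of angles and the tridiagonal Gram matrix. -/

/-- The sine of the angle from `θ i` to `θ j`. -/
noncomputable def gapSin (θ : ℕ → ℝ) (i j : ℕ) : ℝ := Real.sin (θ j - θ i)

/-- The functions `t ↦ sin (t - x)` span a two-dimensional space, so their values at three points
satisfy a fixed linear relation. -/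
theorem sin_sub_ptolemy (a b c x : ℝ) :
    Real.sin (b - a) * Real.sin (c - x) =
      Real.sin (c - a) * Real.sin (b - x) - Real.sin (c - b) * Real.sin (a - x) := by
  simp only [Real.sin_sub]
  ring

theorem gapSin_self (θ : ℕ → ℝ) (i : ℕ) : gapSin θ i i = 0 := by
  simp [gapSin]

theorem gapSin_pos {d : ℕ} {θ : ℕ → ℝ} (hθ : StrictMono θ)
    (hper : ∀ j, θ (j + (d + 2)) = θ j + Real.pi) {i j : ℕ} (hij : i < j)
    (hji : j < i + (d + 2)) : 0 < gapSin θ i j := by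
  have h1 := hθ hij
  have h2 := hθ hji
  rw [hper] at h2
  exact Real.sin_pos_of_pos_of_lt_pi (by linarith) (by linarith)

theorem gapSin_period {d : ℕ} {θ : ℕ → ℝ} (hper : ∀ j, θ (j + (d + 2)) = θ j + Real.pi) (i : ℕ) :
    gapSin θ i (i + (d + 2)) = 0 := by
  simp [gapSin, hper]

/-- The prescribed inner products of consecutive edge directions. -/
noncomputable def edgeGram (θ : ℕ → ℝ) (i j : ℕ) : ℝ :=
  if i = j then gapSin θ i (i + 2) / (gapSin θ i (i + 1) * gapSin θ (i + 1) (i + 2))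
  else if i + 1 = j then -1 / gapSin θ j (j + 1)
  else if j + 1 = i then -1 / gapSin θ i (i + 1)
  else 0

theorem edgeGram_comm (θ : ℕ → ℝ) (i j : ℕ) : edgeGram θ i j = edgeGram θ j i := by
  unfold edgeGram
  split_ifs <;> first | rfl | omega | (subst_vars; rfl)

theorem edgeGram_self (θ : ℕ → ℝ) (i : ℕ) : edgeGram θ i i =
    gapSin θ i (i + 2) / (gapSin θ i (i + 1) * gapSin θ (i + 1) (i + 2)) := by
  simp [edgeGram]

theorem edgeGram_succ (θ : ℕ → ℝ) (i : ℕ) :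
    edgeGram θ i (i + 1) = -1 / gapSin θ (i + 1) (i + 2) := by
  simp [edgeGram]

theorem edgeGram_of_add_one_lt (θ : ℕ → ℝ) {i j : ℕ} (h : i + 1 < j) : edgeGram θ i j = 0 := by
  unfold edgeGram
  split_ifs <;> first | rfl | omega

/-- The sines of the angles seen from `θ k` are annihilated by the tridiagonal matrix `edgeGram`. -/
theorem gapSin_mul_edgeGram_self {d : ℕ} {θ : ℕ → ℝ} (hθ : StrictMono θ)
    (hper : ∀ j, θ (j + (d + 2)) = θ j + Real.pi) (k i : ℕ) :
    gapSin θ k (i + 1) * edgeGram θ i i =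
      gapSin θ k (i + 2) / gapSin θ (i + 1) (i + 2) + gapSin θ k i / gapSin θ i (i + 1) := by
  have h1 : 0 < gapSin θ i (i + 1) := gapSin_pos hθ hper (by omega) (by omega)
  have h2 : 0 < gapSin θ (i + 1) (i + 2) := gapSin_pos hθ hper (by omega) (by omega)
  rw [edgeGram_self]
  have := sin_sub_ptolemy (θ i) (θ (i + 1)) (θ (i + 2)) (θ k)
  change gapSin θ i (i + 1) * gapSin θ k (i + 2) =
    gapSin θ i (i + 2) * gapSin θ k (i + 1) - gapSin θ (i + 1) (i + 2) * gapSin θ k i at this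
  field_simp
  linarith

/-! ### Realizing the Gram matrix by vectors of `ℝ^d`. -/

/-- An orthogonal frame of `ℝ^d` with prescribed nonnegative squared lengths, numbered from `1`. -/
theorem exists_orthogonal_frame (d : ℕ) (c : ℕ → ℝ) (hc0 : c 0 = 0)
    (hc : ∀ m, 1 ≤ m → m ≤ d → 0 < c m) :
    ∃ h : ℕ → EuclideanSpace ℝ (Fin d), h 0 = 0 ∧
      (∀ i j, i ≤ d → j ≤ d → inner ℝ (h i) (h j) = if i = j then c i else 0) ∧
      Submodule.span ℝ (h '' Set.Iic d) = ⊤ := by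
  let f : ℕ → EuclideanSpace ℝ (Fin d) := fun m =>
    if hm : 1 ≤ m ∧ m ≤ d then
      √(c m) • EuclideanSpace.basisFun (Fin d) ℝ ⟨m - 1, by omega⟩ else 0
  have hf0 : f 0 = 0 := by simp [f]
  refine ⟨f, hf0, ?_, ?_⟩
  · intro i j hi hj
    rcases Nat.eq_zero_or_pos i with rfl | hi0
    · rw [hf0, inner_zero_left, hc0, ite_self]
    rcases Nat.eq_zero_or_pos j with rfl | hj0
    · rw [hf0, inner_zero_right, if_neg (by omega)]
    have hfi : f i = √(c i) • EuclideanSpace.basisFun (Fin d) ℝ ⟨i - 1, by omega⟩ :=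
      dif_pos ⟨hi0, hi⟩
    have hfj : f j = √(c j) • EuclideanSpace.basisFun (Fin d) ℝ ⟨j - 1, by omega⟩ :=
      dif_pos ⟨hj0, hj⟩
    rw [hfi, hfj, inner_smul_left, inner_smul_right,
      orthonormal_iff_ite.1 (EuclideanSpace.basisFun (Fin d) ℝ).orthonormal]
    by_cases hij : i = j
    · subst hij
      simp [Real.mul_self_sqrt (hc i hi0 hi).le]
    · rw [if_neg (by simp; omega), if_neg hij]
      simp
  · rw [eq_top_iff, ← (EuclideanSpace.basisFun (Fin d) ℝ).toBasis.span_eq, Submodule.span_le]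
    rintro _ ⟨a, rfl⟩
    have ha := a.2
    have hfa : f (a + 1) = √(c (a + 1)) • EuclideanSpace.basisFun (Fin d) ℝ a :=
      dif_pos ⟨by omega, by omega⟩
    have hpos : √(c (a + 1)) ≠ 0 := (Real.sqrt_pos.2 (hc _ (by omega) (by omega))).ne'
    have hmem : f (a + 1) ∈ Submodule.span ℝ (f '' Set.Iic d) :=
      Submodule.subset_span ⟨a + 1, Set.mem_Iic.2 (by omega), rfl⟩
    rw [hfa] at hmem
    simpa using (Submodule.smul_mem_iff _ hpos).1 hmem

/-- The first `d` edge directions. -/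
theorem exists_initial_edges {d : ℕ} {θ : ℕ → ℝ} (hθ : StrictMono θ)
    (hper : ∀ j, θ (j + (d + 2)) = θ j + Real.pi) :
    ∃ b : ℕ → EuclideanSpace ℝ (Fin d),
      (∀ i j, i < d → j < d → inner ℝ (b i) (b j) = edgeGram θ i j) ∧
      Submodule.span ℝ (b '' Set.Iio d) = ⊤ := by
  have hpos : ∀ {i j : ℕ}, i < j → j < i + (d + 2) → 0 < gapSin θ i j :=
    fun h1 h2 => gapSin_pos hθ hper h1 h2
  -- The partial sums of the kernel relation are orthogonal for the prescribed form; `h m` is the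
  -- `m`-th one, with its squared length. At `m = d + 1` this length would be `0`, so `d` dimensions
  -- suffice. Differences of the `h m` recover the edges.
  obtain ⟨h, h0, hin, hspan⟩ := exists_orthogonal_frame d
    (fun m => gapSin θ 0 m * gapSin θ 0 (m + 1) / gapSin θ m (m + 1))
    (by simp [gapSin_self]) (fun m hm hmd =>
      div_pos (mul_pos (hpos (by omega) (by omega)) (hpos (by omega) (by omega)))
        (hpos (by omega) (by omega)))
  refine ⟨fun j => (gapSin θ 0 (j + 1))⁻¹ • (h (j + 1) - h j), ?_, ?_⟩
  · have key : ∀ i j, i ≤ j → i < d → j < d →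
        inner ℝ ((gapSin θ 0 (i + 1))⁻¹ • (h (i + 1) - h i))
          ((gapSin θ 0 (j + 1))⁻¹ • (h (j + 1) - h j)) = edgeGram θ i j := by
      intro i j hij hi hj
      have u1 : 0 < gapSin θ 0 (i + 1) := hpos (by omega) (by omega)
      have v1 : 0 < gapSin θ i (i + 1) := hpos (by omega) (by omega)
      have v2 : 0 < gapSin θ (i + 1) (i + 2) := hpos (by omega) (by omega)
      rw [inner_smul_left, inner_smul_right, inner_sub_left, inner_sub_right, inner_sub_right,
        hin _ _ (by omega) (by omega), hin _ _ (by omega) (by omega),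
        hin _ _ (by omega) (by omega), hin _ _ (by omega) (by omega)]
      rcases hij.eq_or_lt with rfl | hlt
      · have := gapSin_mul_edgeGram_self hθ hper 0 i
        rw [← mul_right_inj' u1.ne', this]
        simp only [if_true, Nat.succ_ne_self, if_false, conj_trivial,
          if_neg (show ¬ i = i + 1 by omega)]
        field_simp
        ring
      rcases (Nat.succ_le_of_lt hlt).eq_or_lt with rfl | hlt2
      · have u2 : 0 < gapSin θ 0 (i + 2) := hpos (by omega) (by omega)
        rw [edgeGram_succ, if_neg (by omega), if_pos rfl, if_neg (by omega), if_neg (by omega)]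
        simp only [conj_trivial, Nat.succ_eq_add_one, add_assoc, Nat.reduceAdd]
        field_simp
        ring
      · rw [edgeGram_of_add_one_lt θ hlt2, if_neg (by omega), if_neg (by omega),
          if_neg (by omega), if_neg (by omega)]
        simp
    intro i j hi hj
    rcases le_total i j with hij | hij
    · exact key i j hij hi hj
    · rw [real_inner_comm, edgeGram_comm]
      exact key j i hij hj hi
  · rw [eq_top_iff, ← hspan, Submodule.span_le]
    rintro _ ⟨m, hm, rfl⟩
    rw [Set.mem_Iic] at hm
    induction m with
    | zero => rw [h0]; exact Submodule.zero_mem _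
    | succ m ih =>
      have u1 : 0 < gapSin θ 0 (m + 1) := hpos (by omega) (by omega)
      have hmem := Submodule.subset_span (R := ℝ) (Set.mem_image_of_mem
        (fun j => (gapSin θ 0 (j + 1))⁻¹ • (h (j + 1) - h j)) (Set.mem_Iio.2 (show m < d by omega)))
      have := Submodule.add_mem _ ((Submodule.smul_mem_iff _ (inv_ne_zero u1.ne')).1 hmem)
        (ih (by omega))
      simpa using this

/-! ### Continuing the edge directions indefinitely. -/

/-- Edge directions `E j`, continued from the first `d` ones by a linear recurrence. -/
noncomputable def edgeDir {d : ℕ} (θ : ℕ → ℝ) (b : ℕ → EuclideanSpace ℝ (Fin d)) :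
    ℕ → EuclideanSpace ℝ (Fin d)
  | m => if m < d then b m else
      -(gapSin θ (m - d) (m + 1))⁻¹ •
        ∑ a : Fin d, gapSin θ (m - d) (m - d + a + 1) • edgeDir θ b (m - d + a)
  decreasing_by omega

theorem edgeDir_of_lt {d : ℕ} (θ : ℕ → ℝ) (b : ℕ → EuclideanSpace ℝ (Fin d)) {m : ℕ}
    (hm : m < d) : edgeDir θ b m = b m := by
  rw [edgeDir, if_pos hm]

theorem gapSin_smul_edgeDir {d : ℕ} {θ : ℕ → ℝ} (hθ : StrictMono θ)
    (hper : ∀ j, θ (j + (d + 2)) = θ j + Real.pi) (b : ℕ → EuclideanSpace ℝ (Fin d)) (k : ℕ) :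
    gapSin θ k (k + d + 1) • edgeDir θ b (k + d) =
      -∑ a ∈ Finset.range d, gapSin θ k (k + a + 1) • edgeDir θ b (k + a) := by
  have hpos : 0 < gapSin θ k (k + d + 1) := gapSin_pos hθ hper (by omega) (by omega)
  rw [edgeDir, if_neg (by omega), Nat.add_sub_cancel, smul_smul, mul_neg,
    mul_inv_cancel₀ hpos.ne', neg_one_smul,
    ← Fin.sum_univ_eq_sum_range (fun a => gapSin θ k (k + a + 1) • edgeDir θ b (k + a))]

theorem sum_gapSin_smul_edgeDir {d : ℕ} {θ : ℕ → ℝ} (hθ : StrictMono θ)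
    (hper : ∀ j, θ (j + (d + 2)) = θ j + Real.pi) (b : ℕ → EuclideanSpace ℝ (Fin d)) (k : ℕ) :
    ∑ a ∈ Finset.range (d + 1), gapSin θ k (k + a + 1) • edgeDir θ b (k + a) = 0 := by
  rw [Finset.sum_range_succ, gapSin_smul_edgeDir hθ hper, add_neg_cancel]

/-- Inner products with partial sums of the linear relation telescope. -/
theorem inner_partial_sum_edgeDir {d : ℕ} {θ : ℕ → ℝ} (hθ : StrictMono θ)
    (hper : ∀ j, θ (j + (d + 2)) = θ j + Real.pi) {E : ℕ → EuclideanSpace ℝ (Fin d)} {k N : ℕ}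
    {a : ℕ} (hE : ∀ i < N, inner ℝ (E (k + i)) (E (k + a)) = edgeGram θ (k + i) (k + a)) {l : ℕ}
    (hl : l ≤ N) :
    inner ℝ (∑ i ∈ Finset.range l, gapSin θ k (k + i + 1) • E (k + i)) (E (k + a)) =
      if l = a then -(gapSin θ k (k + a) / gapSin θ (k + a) (k + a + 1))
      else if l = a + 1 then gapSin θ k (k + a + 2) / gapSin θ (k + a + 1) (k + a + 2)
      else 0 := by
  induction l with
  | zero =>
    rcases Nat.eq_zero_or_pos a with rfl | ha
    · simp [gapSin_self]
    · rw [if_neg (by omega), if_neg (by omega)]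
      simp
  | succ l ih =>
    rw [Finset.sum_range_succ, inner_add_left, ih (by omega), inner_smul_left, hE l (by omega),
      conj_trivial]
    rcases lt_trichotomy l a with h | rfl | h
    · rw [if_neg (by omega), if_neg (by omega), if_neg (show ¬ l + 1 = a + 1 by omega)]
      rcases (Nat.succ_le_of_lt h).eq_or_lt with rfl | h2
      · rw [if_pos rfl]
        have := edgeGram_succ θ (k + l)
        simp only [Nat.succ_eq_add_one, ← add_assoc] at *
        rw [this]
        ring
      · rw [if_neg (by omega), edgeGram_of_add_one_lt θ (by omega)]
        simp
    · rw [if_pos rfl, if_neg (by omega), if_pos rfl, gapSin_mul_edgeGram_self hθ hper]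
      ring
    · rw [if_neg (by omega), if_neg (show ¬ l + 1 = a by omega),
        if_neg (show ¬ l + 1 = a + 1 by omega), edgeGram_comm]
      rcases (Nat.succ_le_of_lt h).eq_or_lt with rfl | h2
      · rw [if_pos rfl]
        have := edgeGram_succ θ (k + a)
        simp only [Nat.succ_eq_add_one, ← add_assoc] at *
        rw [this]
        simp only [add_assoc, Nat.reduceAdd]
        ring
      · rw [if_neg (by omega), edgeGram_of_add_one_lt θ (by omega)]
        simp

/-- If `d` consecutive edge directions have the prescribed inner products, so have the `d + 1`
consecutive ones that start at the same index. -/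
theorem inner_edgeDir_step {d : ℕ} {θ : ℕ → ℝ} (hθ : StrictMono θ)
    (hper : ∀ j, θ (j + (d + 2)) = θ j + Real.pi) (b : ℕ → EuclideanSpace ℝ (Fin d)) (k : ℕ)
    (hE : ∀ i j, i < d → j < d →
      inner ℝ (edgeDir θ b (k + i)) (edgeDir θ b (k + j)) = edgeGram θ (k + i) (k + j)) :
    ∀ i j, i ≤ d → j ≤ d →
      inner ℝ (edgeDir θ b (k + i)) (edgeDir θ b (k + j)) = edgeGram θ (k + i) (k + j) := by
  have hpos : 0 < gapSin θ k (k + d + 1) := gapSin_pos hθ hper (by omega) (by omega)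
  -- The linear relation is paired with an earlier direction; the partial sum of length `d`
  -- contributes only for `j = d - 1`.
  have hlast : ∀ j < d, inner ℝ (edgeDir θ b (k + d)) (edgeDir θ b (k + j)) =
      edgeGram θ (k + d) (k + j) := by
    intro j hj
    rw [← mul_right_inj' hpos.ne', ← real_inner_smul_left, gapSin_smul_edgeDir hθ hper,
      inner_neg_left, inner_partial_sum_edgeDir hθ hper (fun i hi => hE i j hi hj) le_rfl,
      if_neg (by omega), edgeGram_comm]
    rcases (Nat.succ_le_of_lt hj).eq_or_lt with h | h2
    · rw [if_pos h.symm, show k + d = k + j + 1 by omega, edgeGram_succ]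
      simp only [add_assoc, Nat.reduceAdd]
      ring
    · rw [if_neg (by omega), edgeGram_of_add_one_lt θ (by omega)]
      simp
  have hdiag : inner ℝ (edgeDir θ b (k + d)) (edgeDir θ b (k + d)) =
      edgeGram θ (k + d) (k + d) := by
    -- The half-turn after `d + 2` steps kills one term of the kernel identity, which makes the
    -- squared norm correct.
    have hk := gapSin_mul_edgeGram_self hθ hper k (k + d)
    rw [show k + d + 2 = k + (d + 2) by omega, gapSin_period hper, zero_div, zero_add] at hk
    rw [← mul_right_inj' hpos.ne', ← real_inner_smul_left, gapSin_smul_edgeDir hθ hper,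
      inner_neg_left, inner_partial_sum_edgeDir hθ hper
        (fun i hi => by rw [real_inner_comm, edgeGram_comm]; exact hlast i hi) le_rfl,
      if_pos rfl, neg_neg, hk]
  intro i j hi hj
  rcases hi.eq_or_lt with rfl | hi
  · rcases hj.eq_or_lt with rfl | hj
    · exact hdiag
    · exact hlast j hj
  · rcases hj.eq_or_lt with rfl | hj
    · rw [real_inner_comm, edgeGram_comm]
      exact hlast i hi
    · exact hE i j hi hj

/-- In the linear relation the coefficient of `edgeDir θ b k` is nonzero, so this vector lies in the
span of the next `d`. -/
theorem span_edgeDir_step {d : ℕ} {θ : ℕ → ℝ} (hθ : StrictMono θ)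
    (hper : ∀ j, θ (j + (d + 2)) = θ j + Real.pi) (b : ℕ → EuclideanSpace ℝ (Fin d)) (k : ℕ)
    (hspan : Submodule.span ℝ (edgeDir θ b '' Set.Ico k (k + d)) = ⊤) :
    Submodule.span ℝ (edgeDir θ b '' Set.Ico (k + 1) (k + 1 + d)) = ⊤ := by
  rw [eq_top_iff, ← hspan, Submodule.span_le]
  have hmem : ∀ m, k + 1 ≤ m → m < k + 1 + d →
      edgeDir θ b m ∈ Submodule.span ℝ (edgeDir θ b '' Set.Ico (k + 1) (k + 1 + d)) :=
    fun m h1 h2 => Submodule.subset_span ⟨m, ⟨h1, h2⟩, rfl⟩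
  rintro _ ⟨m, ⟨h1, h2⟩, rfl⟩
  rcases h1.eq_or_lt with rfl | h1
  · have hpos : 0 < gapSin θ k (k + 1) := gapSin_pos hθ hper (by omega) (by omega)
    have hsum := sum_gapSin_smul_edgeDir hθ hper b k
    rw [Finset.sum_range_succ'] at hsum
    refine (Submodule.smul_mem_iff _ hpos.ne').1 ?_
    have := eq_neg_of_add_eq_zero_right hsum
    rw [add_zero] at this
    rw [this]
    refine Submodule.neg_mem _ (Submodule.sum_mem _ fun i hi => Submodule.smul_mem _ _ ?_)
    have := Finset.mem_range.1 hi
    exact hmem _ (by omega) (by omega)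
  · exact hmem _ h1 (by omega)

/-- The combination `F x` depends linearly on `sin x` and `cos x`. It vanishes at `θ k` and `θ (k +
1)` by the relations that start there, hence also at `θ (k + 2)`. Comparison with the relation that
starts at `k + 2` leaves only the two extreme terms, with equal coefficients up to sign. -/
theorem edgeDir_antiperiodic {d : ℕ} {θ : ℕ → ℝ} (hθ : StrictMono θ)
    (hper : ∀ j, θ (j + (d + 2)) = θ j + Real.pi) (b : ℕ → EuclideanSpace ℝ (Fin d)) (k : ℕ) :
    edgeDir θ b (k + (d + 2)) = -edgeDir θ b k := by
  set E := edgeDir θ b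
  let F : ℝ → EuclideanSpace ℝ (Fin d) := fun x =>
    ∑ a ∈ Finset.range (d + 2), Real.sin (θ (k + a + 1) - x) • E (k + a)
  have h0 : F (θ k) = 0 := by
    have h := sum_gapSin_smul_edgeDir hθ hper b k
    have hz := gapSin_period hper k
    simp only [F]
    rw [Finset.sum_range_succ]
    refine (congrArg₂ (· + ·) h ?_).trans (add_zero 0)
    change gapSin θ k (k + (d + 2)) • _ = _
    rw [hz, zero_smul]
  have h1 : F (θ (k + 1)) = 0 := by
    have h := sum_gapSin_smul_edgeDir hθ hper b (k + 1)
    simp only [F]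
    rw [Finset.sum_range_succ']
    simp only [add_zero, sub_self, Real.sin_zero, zero_smul]
    rw [← h]
    refine Finset.sum_congr rfl fun i _ => ?_
    rw [show k + (i + 1) = k + 1 + i by omega]
    rfl
  have h2 : F (θ (k + 2)) = 0 := by
    have hpos : 0 < gapSin θ k (k + 1) := gapSin_pos hθ hper (by omega) (by omega)
    refine (smul_eq_zero.1 ?_).resolve_left hpos.ne'
    have : gapSin θ k (k + 1) • F (θ (k + 2)) =
        gapSin θ k (k + 2) • F (θ (k + 1)) - gapSin θ (k + 1) (k + 2) • F (θ k) := by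
      simp only [F, Finset.smul_sum, smul_smul]
      rw [← Finset.sum_sub_distrib]
      refine Finset.sum_congr rfl fun i _ => ?_
      rw [← sub_smul]
      congr 1
      have := sin_sub_ptolemy (θ k) (θ (k + 1)) (θ (k + 2)) (θ (k + i + 1))
      simp only [gapSin]
      rw [← neg_sub (θ (k + 2)) (θ (k + i + 1)), ← neg_sub (θ (k + 1)) (θ (k + i + 1)),
        ← neg_sub (θ k) (θ (k + i + 1)), Real.sin_neg, Real.sin_neg, Real.sin_neg]
      linarith
    rw [this, h0, h1, smul_zero, smul_zero, sub_zero]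
  have h3 := sum_gapSin_smul_edgeDir hθ hper b (k + 2)
  simp only [F] at h2
  rw [Finset.sum_range_succ', Finset.sum_range_succ'] at h2
  rw [Finset.sum_range_succ] at h3
  have hsame : ∑ a ∈ Finset.range d, Real.sin (θ (k + (a + 1 + 1) + 1) - θ (k + 2)) •
      E (k + (a + 1 + 1)) =
      ∑ a ∈ Finset.range d, gapSin θ (k + 2) (k + 2 + a + 1) • E (k + 2 + a) := by
    refine Finset.sum_congr rfl fun i _ => ?_
    rw [show k + (i + 1 + 1) = k + 2 + i by omega]
    rfl
  have hpos : 0 < gapSin θ (k + 1) (k + 2) := gapSin_pos hθ hper (by omega) (by omega)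
  have hs1 : gapSin θ (k + 2) (k + 2 + d + 1) = gapSin θ (k + 1) (k + 2) := by
    rw [gapSin, show k + 2 + d + 1 = k + 1 + (d + 2) by omega, hper, gapSin,
      show θ (k + 1) + Real.pi - θ (k + 2) = Real.pi - (θ (k + 2) - θ (k + 1)) by ring,
      Real.sin_pi_sub]
  have hs2 : Real.sin (θ (k + 0 + 1) - θ (k + 2)) = -gapSin θ (k + 1) (k + 2) := by
    rw [gapSin, ← Real.sin_neg, neg_sub]
  rw [hsame, hs2, show k + (0 + 1) + 1 = k + 2 by omega, sub_self, Real.sin_zero, zero_smul,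
    add_zero, add_zero] at h2
  change _ + _ • E (k + 2 + d) = _ at h3
  change ∑ a ∈ Finset.range d, gapSin θ (k + 2) (k + 2 + a + 1) • E (k + 2 + a) + _ = _ at h3
  rw [hs1, show k + 2 + d = k + (d + 2) by omega] at h3
  have h4 := h3.trans h2.symm
  rw [add_right_inj, neg_smul, ← smul_neg] at h4
  exact smul_right_injective _ hpos.ne' h4

/-- Edge directions for every system of angles. -/
theorem exists_edge_directions {d : ℕ} {θ : ℕ → ℝ} (hθ : StrictMono θ)
    (hper : ∀ j, θ (j + (d + 2)) = θ j + Real.pi) :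
    ∃ E : ℕ → EuclideanSpace ℝ (Fin d),
      (∀ i j, i ≤ j → j ≤ i + d → inner ℝ (E i) (E j) = edgeGram θ i j) ∧
      (∀ k, Submodule.span ℝ (E '' Set.Ico k (k + d)) = ⊤) ∧
      ∀ k, E (k + (d + 2)) = -E k := by
  obtain ⟨b, hb, hspan⟩ := exists_initial_edges hθ hper
  refine ⟨edgeDir θ b, ?_, ?_, edgeDir_antiperiodic hθ hper b⟩
  · have hwin : ∀ k i j, i < d → j < d → inner ℝ (edgeDir θ b (k + i)) (edgeDir θ b (k + j)) =
        edgeGram θ (k + i) (k + j) := by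
      intro k
      induction k with
      | zero =>
        intro i j hi hj
        rw [zero_add, zero_add, edgeDir_of_lt θ b hi, edgeDir_of_lt θ b hj, hb i j hi hj]
      | succ k ih =>
        intro i j hi hj
        have := inner_edgeDir_step hθ hper b k ih (i + 1) (j + 1) hi hj
        rwa [← add_assoc, ← add_assoc, Nat.add_right_comm k i, Nat.add_right_comm k j] at this
    intro i j hij hji
    have := inner_edgeDir_step hθ hper b i (hwin i) 0 (j - i) (by omega) (by omega)
    rwa [add_zero, Nat.add_sub_cancel' hij] at this
  · intro k
    induction k with
    | zero =>
      rw [← hspan, zero_add]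
      congr 1
      rw [← Nat.bot_eq_zero, Set.Ico_bot]
      exact Set.image_congr fun m hm => edgeDir_of_lt θ b hm
    | succ k ih => exact span_edgeDir_step hθ hper b k ih

/-! ### From edge directions to an ICS. -/

/-- Rescaling factors that turn the edge directions into the edges of a sequence in which every
point is equidistant from the points before it. -/
noncomputable def edgeScale (θ : ℕ → ℝ) (k : ℕ) : ℝ :=
  ∏ i ∈ Finset.range k, gapSin θ i (i + 2) / (2 * gapSin θ i (i + 1))

theorem edgeScale_succ (θ : ℕ → ℝ) (k : ℕ) : edgeScale θ (k + 1) =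
    edgeScale θ k * (gapSin θ k (k + 2) / (2 * gapSin θ k (k + 1))) :=
  Finset.prod_range_succ _ _

theorem edgeScale_zero (θ : ℕ → ℝ) : edgeScale θ 0 = 1 := Finset.prod_range_zero _

theorem edgeScale_pos {d : ℕ} (hd : 0 < d) {θ : ℕ → ℝ} (hθ : StrictMono θ)
    (hper : ∀ j, θ (j + (d + 2)) = θ j + Real.pi) (k : ℕ) : 0 < edgeScale θ k :=
  Finset.prod_pos fun i _ => div_pos (gapSin_pos hθ hper (by omega) (by omega))
    (mul_pos two_pos (gapSin_pos hθ hper (by omega) (by omega)))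

theorem edgeScale_add_period {d : ℕ} {θ : ℕ → ℝ} (hper : ∀ j, θ (j + (d + 2)) = θ j + Real.pi)
    (k : ℕ) : edgeScale θ (k + (d + 2)) = edgeScale θ (d + 2) * edgeScale θ k := by
  have hshift : ∀ i j, gapSin θ (i + (d + 2)) (j + (d + 2)) = gapSin θ i j := by
    intro i j
    rw [gapSin, hper, hper, add_sub_add_right_eq_sub, gapSin]
  induction k with
  | zero => rw [zero_add, edgeScale_zero, mul_one]
  | succ k ih =>
    rw [Nat.add_right_comm, edgeScale_succ, ih, edgeScale_succ θ k, Nat.add_right_comm k (d + 2) 2,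
      Nat.add_right_comm k (d + 2) 1, hshift, hshift, mul_assoc]

/-- If every edge is orthogonal to the `d` next ones, except that it makes the inner product
`-‖e k‖ ^ 2 / 2` with its successor, then every point is equidistant from the `d + 1` points
before it. -/
theorem dist_sum_edges {d : ℕ} {V : Type*} [NormedAddCommGroup V] [InnerProductSpace ℝ V]
    {e : ℕ → V} (hsucc : ∀ k, inner ℝ (e k) (e (k + 1)) = -(‖e k‖ ^ 2 / 2))
    (horth : ∀ i j, i + 1 < j → j ≤ i + d → inner ℝ (e i) (e j) = 0) (m l : ℕ) (hl : l ≤ d)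
    (hlm : l ≤ m) :
    dist (∑ j ∈ Finset.range (m - l), e j) (∑ j ∈ Finset.range (m + 1), e j) = ‖e m‖ := by
  rw [dist_comm, dist_eq_norm]
  have hsum : ∑ j ∈ Finset.range (m + 1), e j - ∑ j ∈ Finset.range (m - l), e j =
      ∑ j ∈ Finset.Ico (m - l) (m + 1), e j := by
    rw [Finset.sum_Ico_eq_sub _ (by omega)]
  rw [hsum]
  clear hsum
  induction l with
  | zero => simp
  | succ l ih =>
    have ih := ih (by omega) (by omega)
    have hstep : m - l = m - (l + 1) + 1 := by omega
    rw [Finset.sum_eq_sum_Ico_succ_bot (by omega), ← hstep]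
    -- The prepended edge meets the remaining sum only through its successor, so its squared norm
    -- cancels twice the inner product.
    have hin : inner ℝ (e (m - (l + 1))) (∑ j ∈ Finset.Ico (m - l) (m + 1), e j) =
        -(‖e (m - (l + 1))‖ ^ 2 / 2) := by
      rw [Finset.sum_eq_sum_Ico_succ_bot (by omega), inner_add_right, inner_sum,
        Finset.sum_eq_zero, add_zero, hstep, hsucc]
      intro j hj
      rw [Finset.mem_Ico] at hj
      exact horth _ _ (by omega) (by omega)
    rw [← sq_eq_sq₀ (norm_nonneg _) (norm_nonneg _), norm_add_sq_real, hin, ih]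
    ring

/-- A window of points is in general position if its edges span. -/
theorem vectorSpan_sum_edges {d : ℕ} {V : Type*} [AddCommGroup V] [Module ℝ V] (e : ℕ → V) (k : ℕ)
    (hspan : Submodule.span ℝ (e '' Set.Ico k (k + d)) = ⊤) :
    vectorSpan ℝ (Set.range fun a : Fin (d + 1) => ∑ j ∈ Finset.range (k + a), e j) = ⊤ := by
  rw [eq_top_iff, ← hspan, Submodule.span_le]
  rintro _ ⟨m, ⟨h1, h2⟩, rfl⟩
  have h := vsub_mem_vectorSpan ℝ
    (Set.mem_range_self (f := fun a : Fin (d + 1) => ∑ j ∈ Finset.range (k + a), e j)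
      ⟨m + 1 - k, by omega⟩)
    (Set.mem_range_self (f := fun a : Fin (d + 1) => ∑ j ∈ Finset.range (k + a), e j)
      ⟨m - k, by omega⟩)
  simpa [show k + (m + 1 - k) = m + 1 by omega, show k + (m - k) = m by omega,
    Finset.sum_range_succ] using h

/-- A sequence whose windows of `d + 1` edges have the right shape is a special ICS. -/
theorem isSpecialICS_sum_edges {d : ℕ} {e : ℕ → EuclideanSpace ℝ (Fin d)}
    (hsucc : ∀ k, inner ℝ (e k) (e (k + 1)) = -(‖e k‖ ^ 2 / 2))
    (horth : ∀ i j, i + 1 < j → j ≤ i + d → inner ℝ (e i) (e j) = 0)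
    (hspan : ∀ k, Submodule.span ℝ (e '' Set.Ico k (k + d)) = ⊤) :
    IsSpecialICS d fun k => ∑ j ∈ Finset.range k, e j := by
  have hind : ∀ k, AffineIndependent ℝ
      (fun a : Fin (d + 1) => ∑ j ∈ Finset.range (k + a), e j) := by
    intro k
    rw [affineIndependent_iff_finrank_vectorSpan_eq ℝ _ (Fintype.card_fin (d + 1)),
      vectorSpan_sum_edges e k (hspan k)]
    simp
  have hdist : ∀ i j, i < j → j ≤ i + d + 1 →
      dist (∑ l ∈ Finset.range i, e l) (∑ l ∈ Finset.range j, e l) = ‖e (j - 1)‖ := by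
    intro i j hij hji
    have := dist_sum_edges hsucc horth (j - 1) (j - 1 - i) (by omega) (by omega)
    rwa [show j - 1 - (j - 1 - i) = i by omega, show j - 1 + 1 = j by omega] at this
  refine ⟨fun k => ⟨hind k, ?_⟩, ⟨?_, ?_⟩⟩
  · refine Affine.Simplex.eq_circumcenter_of_dist_eq _ ?_ (r := ‖e (k + d)‖) ?_
    · have : affineSpan ℝ (Set.range
          (fun a : Fin (d + 1) => ∑ j ∈ Finset.range (k + a), e j)) = ⊤ :=
        (AffineSubspace.affineSpan_eq_top_iff_vectorSpan_eq_top_of_nonempty ℝ _ _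
          (Set.range_nonempty _)).2 (vectorSpan_sum_edges e k (hspan k))
      change _ ∈ affineSpan ℝ (Set.range
          (fun a : Fin (d + 1) => ∑ j ∈ Finset.range (k + a), e j))
      rw [this]
      trivial
    · intro a
      exact hdist (k + a) (k + d + 1) (by omega) (by omega)
  · simpa using hind 0
  · intro i j k hj hk
    have h1 : (j : ℕ) < i := hj
    have h2 : (k : ℕ) < i := hk
    exact (hdist j i h1 (by omega)).trans (hdist k i h2 (by omega)).symm

/-! ### Scale factor and periodicity. -/

/-- The product telescopes; its power of `4` cancels the power of `2` in `scaleFactor`, which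
becomes a ratio of two edge lengths. -/
theorem prod_characteristicSeq {d : ℕ} (p : ℕ → EuclideanSpace ℝ (Fin d))
    (hp : ∀ k, dist (p k) (p (k + 1)) ≠ 0) (m : ℕ) :
    ∏ i ∈ Finset.range m, characteristicSeq p i =
      dist (p 0) (p 1) ^ 2 / (4 ^ m * dist (p m) (p (m + 1)) ^ 2) := by
  induction m with
  | zero => simp [hp 0]
  | succ m ih =>
    have h1 := hp m
    have h2 := hp (m + 1)
    rw [Finset.prod_range_succ, ih, characteristicSeq]
    field_simp
    ring

theorem scaleFactor_eq {d : ℕ} (p : ℕ → EuclideanSpace ℝ (Fin d))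
    (hp : ∀ k, dist (p k) (p (k + 1)) ≠ 0) :
    scaleFactor d p = dist (p (d + 2)) (p (d + 3)) / dist (p 0) (p 1) := by
  have h0 : 0 < dist (p 0) (p 1) := lt_of_le_of_ne dist_nonneg (hp 0).symm
  have h1 : 0 < dist (p (d + 2)) (p (d + 3)) := lt_of_le_of_ne dist_nonneg (hp _).symm
  rw [scaleFactor, prod_characteristicSeq p hp, show (4 : ℝ) ^ (d + 2) = (2 ^ (d + 2)) ^ 2 by
    rw [← pow_mul, mul_comm, pow_mul]; norm_num, ← mul_pow, ← div_pow, Real.sqrt_sq (by positivity)]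
  field_simp

/-- Every system of angles gives a special ICS, whose period map is a point reflection composed
with a homothety of ratio the scale factor. -/
theorem exists_specialICS_of_angles {d : ℕ} (hd : 0 < d) {θ : ℕ → ℝ} (hθ : StrictMono θ)
    (hper : ∀ j, θ (j + (d + 2)) = θ j + Real.pi) :
    ∃ p : ℕ → EuclideanSpace ℝ (Fin d), IsSpecialICS d p ∧
      scaleFactor d p = edgeScale θ (d + 2) ∧
      ∀ k, p (k + (d + 2) + 1) - p (k + (d + 2)) = -edgeScale θ (d + 2) • (p (k + 1) - p k) := by
  obtain ⟨E, hE, hspan, hanti⟩ := exists_edge_directions hθ hper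
  have hpos : ∀ {i j : ℕ}, i < j → j < i + (d + 2) → 0 < gapSin θ i j :=
    fun h1 h2 => gapSin_pos hθ hper h1 h2
  have ht := edgeScale_pos hd hθ hper
  have hnormE : ∀ k, ‖E k‖ ^ 2 = edgeGram θ k k := fun k => by
    rw [← real_inner_self_eq_norm_sq, hE k k le_rfl (by omega)]
  have hEpos : ∀ k, 0 < ‖E k‖ := by
    intro k
    have h1 := hpos (show k < k + 2 by omega) (by omega)
    have h2 := hpos (show k < k + 1 by omega) (by omega)
    have h3 := hpos (show k + 1 < k + 2 by omega) (by omega)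
    have : 0 < ‖E k‖ ^ 2 := by
      rw [hnormE, edgeGram_self]
      positivity
    exact lt_of_le_of_ne (norm_nonneg _) fun h => by simp [← h] at this
  let e : ℕ → EuclideanSpace ℝ (Fin d) := fun k => edgeScale θ k • E k
  have hedge : ∀ k, ∑ j ∈ Finset.range (k + 1), e j - ∑ j ∈ Finset.range k, e j = e k := fun k => by
    rw [Finset.sum_range_succ, add_sub_cancel_left]
  have hdist : ∀ k, dist (∑ j ∈ Finset.range k, e j) (∑ j ∈ Finset.range (k + 1), e j) =
      edgeScale θ k * ‖E k‖ := fun k => by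
    rw [dist_comm, dist_eq_norm, hedge, norm_smul, Real.norm_of_nonneg (ht k).le]
  have hper' : ∀ k, e (k + (d + 2)) = -edgeScale θ (d + 2) • e k := fun k => by
    simp only [e]
    rw [hanti, edgeScale_add_period hper, smul_neg, neg_smul, smul_smul]
  refine ⟨fun k => ∑ j ∈ Finset.range k, e j, isSpecialICS_sum_edges ?_ ?_ ?_, ?_, ?_⟩
  · intro k
    have h2 := hpos (show k < k + 1 by omega) (by omega)
    have h3 := hpos (show k + 1 < k + 2 by omega) (by omega)
    simp only [e]
    rw [inner_smul_left, inner_smul_right, hE k (k + 1) (by omega) (by omega), edgeGram_succ,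
      norm_smul, mul_pow, hnormE, edgeGram_self, edgeScale_succ, Real.norm_eq_abs, sq_abs,
      conj_trivial]
    field_simp
  · intro i j hij hji
    simp only [e]
    rw [inner_smul_left, inner_smul_right, hE i j (by omega) hji, edgeGram_of_add_one_lt θ hij,
      mul_zero, mul_zero]
  · intro k
    rw [eq_top_iff, ← hspan k, Submodule.span_le]
    rintro _ ⟨m, hm, rfl⟩
    exact (Submodule.smul_mem_iff _ (ht m).ne').1 (Submodule.subset_span ⟨m, hm, rfl⟩)
  · rw [scaleFactor_eq _ fun k => by rw [hdist]; exact (mul_pos (ht k) (hEpos k)).ne']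
    have h0 := hdist 0
    have h1 := hdist (d + 2)
    rw [zero_add] at h0
    have h2 := hanti 0
    rw [zero_add] at h2
    rw [h0, h1, h2, norm_neg, edgeScale_zero, one_mul, mul_div_cancel_right₀ _ (hEpos 0).ne']
  · intro k
    simp only [hedge, hper']

/-- The edge relation with scale factor `1` makes the sequence periodic. -/
theorem isPeriodicSeq_of_edges_neg {d n : ℕ} (hn : 0 < n) {p : ℕ → EuclideanSpace ℝ (Fin d)}
    (hp : ∀ k, p (k + n + 1) - p (k + n) = -(p (k + 1) - p k)) : IsPeriodicSeq p := by
  -- A shift by `n` acts as reflection in one fixed point; two reflections give the period `n + n`.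
  have hconst : ∀ k, p (k + n) + p k = p n + p 0 := by
    intro k
    induction k with
    | zero => rw [zero_add]
    | succ k ih =>
      rw [← ih, Nat.add_right_comm, eq_add_of_sub_eq (hp k)]
      abel
  refine ⟨n + n, by omega, fun k => ?_⟩
  have h1 := hconst k
  have h2 := hconst (k + n)
  rw [← h1, add_comm] at h2
  rw [← add_assoc]
  exact (add_left_cancel h2).symm

/-! ### Choosing the angles. -/

/-- Angles that increase by `x` at the multiples of `n` and by `y` otherwise. -/
noncomputable def stepAngle (n : ℕ) (x y : ℝ) (k : ℕ) : ℝ :=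
  ∑ i ∈ Finset.range k, if n ∣ i then x else y

theorem stepAngle_succ (n : ℕ) (x y : ℝ) (k : ℕ) :
    stepAngle n x y (k + 1) = stepAngle n x y k + if n ∣ k then x else y :=
  Finset.sum_range_succ _ _

theorem stepAngle_strictMono {n : ℕ} {x y : ℝ} (hx : 0 < x) (hy : 0 < y) :
    StrictMono (stepAngle n x y) :=
  strictMono_nat_of_lt_succ fun k => by
    rw [stepAngle_succ]
    split_ifs <;> linarith

theorem stepAngle_add_period (d : ℕ) {x y : ℝ} (h : x + (d + 1) * y = Real.pi) (k : ℕ) :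
    stepAngle (d + 2) x y (k + (d + 2)) = stepAngle (d + 2) x y k + Real.pi := by
  induction k with
  | zero =>
    rw [zero_add, stepAngle, Finset.sum_range_succ', Finset.sum_congr rfl
      fun i hi => if_neg (Nat.not_dvd_of_pos_of_lt (by omega)
        (by have := Finset.mem_range.1 hi; omega))]
    simp only [stepAngle, Finset.sum_const, Finset.card_range, dvd_zero, if_true, nsmul_eq_mul,
      Finset.range_zero, Finset.sum_empty]
    push_cast
    linarith
  | succ k ih =>
    rw [Nat.add_right_comm, stepAngle_succ, ih, stepAngle_succ]
    simp only [Nat.dvd_add_self_right]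
    ring

/-- Two adjacent gaps `y` contribute `sin (2 * y) / (2 * sin y) = cos y`, and this occurs `d` times;
the two mixed pairs give the remaining factors. -/
theorem edgeScale_stepAngle {d : ℕ} {x y : ℝ} (hy : Real.sin y ≠ 0) :
    edgeScale (stepAngle (d + 2) x y) (d + 2) =
      Real.cos y ^ d * Real.sin (x + y) ^ 2 / (4 * Real.sin x * Real.sin y) := by
  have hone : ∀ k, gapSin (stepAngle (d + 2) x y) k (k + 1) =
      Real.sin (if d + 2 ∣ k then x else y) := fun k => by
    rw [gapSin, stepAngle_succ, add_sub_cancel_left]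
  have htwo : ∀ k, gapSin (stepAngle (d + 2) x y) k (k + 2) =
      Real.sin ((if d + 2 ∣ k then x else y) + if d + 2 ∣ k + 1 then x else y) := fun k => by
    rw [gapSin, stepAngle_succ, stepAngle_succ, add_assoc, add_sub_cancel_left]
  have hmid : ∀ k ∈ Finset.range d, gapSin (stepAngle (d + 2) x y) (k + 1) (k + 1 + 2) /
      (2 * gapSin (stepAngle (d + 2) x y) (k + 1) (k + 1 + 1)) = Real.cos y := by
    intro k hk
    have := Finset.mem_range.1 hk
    rw [hone, htwo, if_neg (Nat.not_dvd_of_pos_of_lt (by omega) (by omega)),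
      if_neg (Nat.not_dvd_of_pos_of_lt (by omega) (by omega)), ← two_mul, Real.sin_two_mul]
    field_simp
  rw [edgeScale, Finset.prod_range_succ, Finset.prod_range_succ', Finset.prod_congr rfl hmid,
    hone, hone, htwo, htwo, if_pos (dvd_zero _),
    if_neg (Nat.not_dvd_of_pos_of_lt (show 0 < 0 + 1 by omega) (by omega)),
    if_neg (Nat.not_dvd_of_pos_of_lt (show 0 < d + 1 by omega) (by omega)),
    if_pos (dvd_refl (d + 2)), Finset.prod_const, Finset.card_range, add_comm y x,
    div_eq_mul_inv, div_eq_mul_inv, div_eq_mul_inv, mul_inv, mul_inv, mul_inv, mul_inv]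
  ring

/-- Every scale factor from `cos (π / (d + 2)) ^ (d + 2)` on is attained by step angles. -/
theorem exists_angles_edgeScale_eq {d : ℕ} (hd : 2 ≤ d) {r : ℝ}
    (hr : Real.cos (Real.pi / ((d : ℝ) + 2)) ^ (d + 2) ≤ r) :
    ∃ θ : ℕ → ℝ, StrictMono θ ∧ (∀ j, θ (j + (d + 2)) = θ j + Real.pi) ∧
      edgeScale θ (d + 2) = r := by
  have hd' : (2 : ℝ) ≤ d := by exact_mod_cast hd
  have hpi := Real.pi_pos
  let y : ℝ → ℝ := fun x => (Real.pi - x) / (d + 1)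
  have hsum : ∀ x, x + (d + 1) * y x = Real.pi := fun x => by
    simp only [y]
    field_simp
    ring
  -- Clearing denominators keeps `φ` continuous at `x = 0`, where the scale factor itself blows up.
  let φ : ℝ → ℝ := fun x => Real.cos (y x) ^ d * Real.sin (x + y x) ^ 2 -
    r * (4 * Real.sin x * Real.sin (y x))
  set z := Real.pi / ((d : ℝ) + 2) with hz
  have hz0 : 0 < z := by positivity
  have hzpi : z < Real.pi := by
    rw [hz, div_lt_iff₀ (by positivity)]
    nlinarith
  have hφ : ContinuousOn φ (Set.Icc 0 z) := by
    have : Continuous φ := by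
      simp only [φ, y]
      fun_prop
    exact this.continuousOn
  have hyz : y z = z := by
    simp only [y, hz]
    field_simp
    ring
  -- At `x = z` all gaps are equal and the scale factor is the lower bound for `r`.
  have hφz : φ z ≤ 0 := by
    have h : φ z = (Real.cos z ^ (d + 2) - r) * (4 * Real.sin z ^ 2) := by
      simp only [φ]
      rw [hyz, ← two_mul, Real.sin_two_mul]
      ring
    rw [h]
    exact mul_nonpos_of_nonpos_of_nonneg (by linarith) (by positivity)
  have hφ0 : 0 < φ 0 := by
    have hy0 : 0 < y 0 := by
      simp only [y, sub_zero]
      positivity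
    -- Here `d ≥ 2` matters: `y 0 = π / (d + 1)` must be less than `π / 2`.
    have hy1 : y 0 < Real.pi / 2 := by
      simp only [y, sub_zero]
      rw [div_lt_iff₀ (by positivity)]
      nlinarith
    have h1 := Real.cos_pos_of_mem_Ioo ⟨by linarith, hy1⟩
    have h2 := Real.sin_pos_of_pos_of_lt_pi hy0 (by linarith)
    simp only [φ, Real.sin_zero, zero_add, mul_zero, zero_mul, sub_zero]
    positivity
  obtain ⟨x, ⟨hx0, hxz⟩, hx⟩ := intermediate_value_Icc' hz0.le hφ ⟨hφz, hφ0.le⟩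
  have hxpos : 0 < x := lt_of_le_of_ne hx0 fun h => by
    rw [← h] at hx
    exact hφ0.ne' hx
  have hypos : 0 < y x := by
    have : 0 < Real.pi - x := by linarith
    simp only [y]
    positivity
  have hylt : y x < Real.pi := by
    simp only [y]
    rw [div_lt_iff₀ (by positivity)]
    nlinarith
  have hsx := Real.sin_pos_of_pos_of_lt_pi hxpos (by linarith)
  have hsy := Real.sin_pos_of_pos_of_lt_pi hypos hylt
  refine ⟨stepAngle (d + 2) x (y x), stepAngle_strictMono hxpos hypos,
    stepAngle_add_period d (hsum x), ?_⟩
  rw [edgeScale_stepAngle hsy.ne', div_eq_iff (by positivity)]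
  simp only [φ] at hx
  linarith

theorem mainTheorem4 (d : ℕ) (hd : 2 ≤ d) :
    (∀ r : ℝ, Real.cos (Real.pi / ((d : ℝ) + 2)) ^ (d + 2) ≤ r →
      ∃ p : ℕ → EuclideanSpace ℝ (Fin d), IsSpecialICS d p ∧ scaleFactor d p = r) ∧
    ∃ p : ℕ → EuclideanSpace ℝ (Fin d), IsICS d p ∧ IsPeriodicSeq p := by
  constructor
  · intro r hr
    obtain ⟨θ, hθ, hper, hscale⟩ := exists_angles_edgeScale_eq hd hr
    obtain ⟨p, hp, hpr, -⟩ := exists_specialICS_of_angles (by omega) hθ hper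
    exact ⟨p, hp, hpr.trans hscale⟩
  -- The value `1` lies in the attained range, and with it the edges satisfy `e (k + (d + 2)) = -e
  -- k`.
  · have hcos : Real.cos (Real.pi / ((d : ℝ) + 2)) ^ (d + 2) ≤ 1 := by
      have hd' : (2 : ℝ) ≤ d := by exact_mod_cast hd
      refine pow_le_one₀ (Real.cos_nonneg_of_mem_Icc ⟨?_, ?_⟩) (Real.cos_le_one _)
      · have : 0 ≤ Real.pi / ((d : ℝ) + 2) := by positivity
        linarith [Real.pi_pos]
      · exact div_le_div_of_nonneg_left Real.pi_pos.le two_pos (by linarith)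
    obtain ⟨θ, hθ, hper, hscale⟩ := exists_angles_edgeScale_eq hd hcos
    obtain ⟨p, hp, -, hedge⟩ := exists_specialICS_of_angles (by omega) hθ hper
    rw [hscale] at hedge
    simp only [neg_smul, one_smul] at hedge
    exact ⟨p, hp.1, isPeriodicSeq_of_edges_neg (by omega) hedge⟩
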